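/- Fix a prime $p$. A fusion system $\mathcal F$ over a finite $p$-group $S$ is a category whose objects are the subgroups of $S$ and whose morphisms are injective homomorphisms, which contains every homomorphism between subgroups of $S$ induced by conjugation in $S$, and in which every morphism is an $\mathcal F$-isomorphism followed by an inclusion. A subgroup $P\le S$ is fully normalized (fully centralized) in $\mathcal F$ if $|N_S(P)|\ge|N_S(Q)|$ (resp. $|C_S(P)|\ge|C_S(Q)|$) for every $Q\le S$ that is $\mathcal F$-isomorphic to $P$; and $P$ is normal in $\mathcal F$ if each morphism in $\mathcal F$ extends to a morphism in $\mathcal F$ whose domain contains $P$ and which sends $P$ to itself. $\mathcal F$ is saturated if (i) each fully normalized $P\le S$ is fully centralized and satisfies $\mathrm{Aut}_S(P)\in\mathrm{Syl}_p(\mathrm{Aut}_{\mathcal F}(P))$, and (ii) each $\mathcal F$-isomorphism $\varphi\colon P\to Q$ with $Q$ fully centralized extends to a morphism in $\mathrm{Hom}_{\mathcal F}(N_\varphi,S)$, where $N_\varphi=\{g\in N_S(P) : \varphi c_g\varphi^{-1}\in\mathrm{Aut}_S(Q)\}$. Corollary 2.9. Let $\Gamma$ be a finite group with $\Gamma=O^{p'}(\Gamma)$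 (i.e. $\Gamma$ has no proper normal subgroup of index prime to $p$), and let $A$ be a finite faithful $\mathbb F_p\Gamma$-module. Assume that there are a saturated fusion system $\mathcal F$ over a finite $p$-group $S$ and an abelian subgroup $D\le S$ such that $C_S(D)=D$, $D$ is not normal in $\mathcal F$, and $(\mathrm{Aut}_{\mathcal F}(D),D)\cong(\Gamma,A)$. Then there are $m\ge1$ and an elementary abelian $p$-subgroup $B\le\Gamma$ of rank $m$ such that, for each $1\ne\tau\in B$, $$\mathrm{rk}\bigl(C_A(\tau)\cap[\tau,A]\bigr)\le m,$$ where $C_A(\tau)=\ker(\tau-1)$ and $[\tau,A]=\mathrm{im}(\tau-1)$. Equivalently, each such $\tau$ acts on $A$ with at most $m$ nontrivial Jordan blocks: in every decomposition of $A$ as a direct sum of indecomposable $\mathbb F_p[X]$-modules, with $X$ acting as $\tau$, at most $m$ summands have nontrivial action of $\tau$. -/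

import Mathlib

/-- A fusion system over a group `S` (in the theorem, a finite `p`-group): a category whose objects
are the subgroups of `S` and whose morphisms are injective homomorphisms, containing all
conjugations by elements of `S` (hence all identities and inclusions), in which every morphism is
an isomorphism of the category followed by an inclusion. -/
structure FusionSystem (S : Type*) [Group S] where
  /-- The set of morphisms from `P` to `Q`. -/
  Hom : ∀ P Q : Subgroup S, Set (P →* Q)
  injective' : ∀ {P Q : Subgroup S} {φ : P →* Q}, φ ∈ Hom P Q → Function.Injective φ
  comp_mem' : ∀ {P Q R : Subgroup S} {φ : P →* Q} {ψ : Q →* R},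
    φ ∈ Hom P Q → ψ ∈ Hom Q R → ψ.comp φ ∈ Hom P R
  conj_mem' : ∀ {P Q : Subgroup S} (g : S) (φ : P →* Q),
    (∀ x : P, (φ x : S) = g * x * g⁻¹) → φ ∈ Hom P Q
  factor' : ∀ {P Q : Subgroup S} {φ : P →* Q}, φ ∈ Hom P Q →
    ∃ (R : Subgroup S) (hR : R ≤ Q) (e : P ≃* R),
      e.toMonoidHom ∈ Hom P R ∧ e.symm.toMonoidHom ∈ Hom R P ∧
        φ = (Subgroup.inclusion hR).comp e.toMonoidHom

namespace FusionSystem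

variable {S : Type*} [Group S] (F : FusionSystem S)

/-- The isomorphisms from `P` to `Q` in the category `F`. -/
def Iso (P Q : Subgroup S) : Set (P ≃* Q) :=
  {e | e.toMonoidHom ∈ F.Hom P Q ∧ e.symm.toMonoidHom ∈ F.Hom Q P}

/-- `P` and `Q` are `F`-conjugate. -/
def Conj (P Q : Subgroup S) : Prop := (F.Iso P Q).Nonempty

/-- The automorphism group `Aut_F(P)`, as a group of automorphisms of `P`. -/
def aut (P : Subgroup S) : Subgroup (MulAut P) where
  carrier := F.Iso P P
  mul_mem' := fun ha hb => ⟨F.comp_mem' hb.1 ha.1, F.comp_mem' ha.2 hb.2⟩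
  one_mem' := ⟨F.conj_mem' 1 _ fun x => by simp, F.conj_mem' 1 _ fun x => by
    change (x : S) = _
    simp⟩
  inv_mem' := fun ha => ⟨ha.2, ha.1⟩

/-- `Aut_S(P)`: the automorphisms of `P` given by conjugation by elements of `N_S(P)`. -/
def autS (P : Subgroup S) : Subgroup (MulAut P) := P.normalizerMonoidHom.range

/-- `P` is fully normalized in `F`. -/
def IsFullyNormalized (P : Subgroup S) : Prop :=
  ∀ Q : Subgroup S, F.Conj P Q →
    Nat.card (Subgroup.normalizer (Q : Set S)) ≤ Nat.card (Subgroup.normalizer (P : Set S))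

/-- `P` is fully centralized in `F`. -/
def IsFullyCentralized (P : Subgroup S) : Prop :=
  ∀ Q : Subgroup S, F.Conj P Q →
    Nat.card (Subgroup.centralizer (Q : Set S)) ≤ Nat.card (Subgroup.centralizer (P : Set S))

/-- `ψ : P' → Q'` extends `φ : P → Q` (all maps being regarded as maps into `S`). -/
def Extends {P Q P' Q' : Subgroup S} (ψ : P' →* Q') (φ : P →* Q) : Prop :=
  ∃ h : P ≤ P', ∀ x : P, (ψ (Subgroup.inclusion h x) : S) = φ x

/-- `N_φ = {g ∈ N_S(P) | φ c_g φ⁻¹ ∈ Aut_S(Q)}`, as a subgroup of `S`. -/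
def extensionDomain {P Q : Subgroup S} (φ : P ≃* Q) : Subgroup S :=
  ((autS Q).comap ((MulAut.congr φ).toMonoidHom.comp P.normalizerMonoidHom)).map
    (Subgroup.normalizer (P : Set S)).subtype

/-- Saturation, by the Sylow axiom and the extension axiom. -/
structure IsSaturated (p : ℕ) : Prop where
  sylow : ∀ P : Subgroup S, F.IsFullyNormalized P →
    F.IsFullyCentralized P ∧ ∃ T : Sylow p (F.aut P),
      (T : Subgroup (F.aut P)).map (F.aut P).subtype = autS P
  extension : ∀ (P Q : Subgroup S) (φ : P ≃* Q), φ ∈ F.Iso P Q → F.IsFullyCentralized Q →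
    ∃ ψ ∈ F.Hom (extensionDomain φ) ⊤, Extends ψ φ.toMonoidHom

/-- `P` is normal in `F`: each morphism in `F` extends to a morphism in `F` that is defined
on `P` and sends `P` to itself. -/
def IsNormal (P : Subgroup S) : Prop :=
  ∀ (Q R : Subgroup S), ∀ φ ∈ F.Hom Q R,
    ∃ (Q' R' : Subgroup S), ∃ ψ ∈ F.Hom Q' R', Extends ψ φ ∧
      P ≤ Q' ∧ ((P.subgroupOf Q').map ψ).map R'.subtype = P

/-- `F` realizes the pair `(Γ, A)`, where `Γ` acts on `A` through `ρ`: there is an abelian subgroup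
`B` of `S` with `C_S(B) = B`, not normal in `F`, such that `(Aut_F(B), B) ≅ (Γ, A)`. -/
def Realizes {p : ℕ} {Γ A : Type*} [Group Γ] [AddCommGroup A] [Module (ZMod p) A]
    (ρ : Representation (ZMod p) Γ A) : Prop :=
  ∃ B : Subgroup S, IsMulCommutative B ∧ Subgroup.centralizer (B : Set S) = B ∧ ¬ F.IsNormal B ∧
    ∃ (χ : Γ ≃* F.aut B) (f : Multiplicative A ≃* B), ∀ (γ : Γ) (a : A),
      f (Multiplicative.ofAdd (ρ γ a)) = (χ γ : MulAut B) (f (Multiplicative.ofAdd a))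

end FusionSystem

/-- `O^{p'}(G)` for a finite group `G`: the smallest normal subgroup of index prime to `p`. -/
def primeToResidual (p : ℕ) (G : Type*) [Group G] : Subgroup G :=
  sInf {N : Subgroup G | N.Normal ∧ ¬ p ∣ N.index}

/-- `B` is an elementary abelian `p`-group of rank `m`. -/
def IsElementaryAbelianOfRank {G : Type*} [Group G] (p m : ℕ) (B : Subgroup G) : Prop :=
  IsMulCommutative B ∧ (∀ x ∈ B, x ^ p = 1) ∧ Nat.card B = p ^ m

section Jordan

variable {K A : Type*} [Field K] [AddCommGroup A] [Module K A]

/-- The number `rk (C_A(τ) ∩ [τ, A])`. -/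
noncomputable def jordanRank (τ : A →ₗ[K] A) : ℕ :=
  Module.finrank K (LinearMap.ker (τ - 1) ⊓ LinearMap.range (τ - 1) : Submodule K A)

/-- `W` is an indecomposable `K[X]`-submodule of `A`, where `X` acts on `A` as `τ`. -/
def IsIndecomposableBlock (τ : A →ₗ[K] A) (W : Submodule K A) : Prop :=
  W ≠ ⊥ ∧ W ≤ W.comap τ ∧ ∀ U V : Submodule K A, U ≤ U.comap τ → V ≤ V.comap τ →
    U ⊓ V = ⊥ → U ⊔ V = W → U = ⊥ ∨ V = ⊥

/-- The submodules `W 0, …, W (n - 1)` form a decomposition of `A` into Jordan blocks for `τ`. -/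
def IsJordanDecomposition (τ : A →ₗ[K] A) {n : ℕ} (W : Fin n → Submodule K A) : Prop :=
  DirectSum.IsInternal W ∧ ∀ i, IsIndecomposableBlock τ (W i)

/-- The number of blocks in the family `W` on which `τ` acts nontrivially. -/
noncomputable def numNontrivialBlocks (τ : A →ₗ[K] A) {n : ℕ} (W : Fin n → Submodule K A) : ℕ :=
  Nat.card {i : Fin n // ∃ a ∈ W i, τ a ≠ a}

end Jordan

/-! Let `D` be the given abelian subgroup. It suffices to find an elementary abelian X ≤ N_S(D), not
inside D, with |X/(X ∩ D)| ≥ |C_D(x) ∩ [x,D]| for all x ∈ X ∖ D (`IsOffending`). Since C_S(D) = D,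
the image of X in Aut_F(D) ≅ Γ is X/(X ∩ D), of order p^m, and taking orders bounds the rank by m.

If D has an F-conjugate D' ≠ D inside N_S(D), take X = D': it centralizes X ∩ D, so |X ∩ D| ≤
|C_D(x)|, while |X| = |D| = |[x,D]||C_D(x)|. Such a D' exists unless D is normal in S and weakly
closed.

In the remaining case D is not strongly closed, because an abelian strongly closed subgroup is
normal in F (`IsStronglyClosed.isNormal`). Choose y ∉ D that is F-conjugate into D, with Z = C_D(y)
∩ [y,D] as large as possible, and then a largest Z₁ ≤ Z such that Y = ⟨y, Z₁⟩ can be moved into D.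
Saturation gives a morphism g on N_S(Y) that takes Y into D, and X = g(N_D(Y)) works by a count
resting on both maximal choices (`exists_isOffending_of_weaklyClosed`). -/

namespace FusionSystem

/-! ### Morphisms as functions on `S`, so that domains can be changed freely -/

variable {S : Type*} [Group S] {F : FusionSystem S}

/-- The function `f` restricts to a morphism of `F` from `P` to `S`. -/
def IsMor (F : FusionSystem S) (P : Subgroup S) (f : S → S) : Prop :=
  ∃ φ ∈ F.Hom P ⊤, ∀ x : P, (φ x : S) = f x

lemma inclusion_mem_hom {P Q : Subgroup S} (h : P ≤ Q) : Subgroup.inclusion h ∈ F.Hom P Q :=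
  F.conj_mem' 1 _ fun x => by simp

lemma exists_isMor {P Q : Subgroup S} {φ : P →* Q} (h : φ ∈ F.Hom P Q) :
    ∃ f, F.IsMor P f ∧ ∀ x : P, f x = φ x := by
  classical
  refine ⟨fun s => if hs : s ∈ P then φ ⟨s, hs⟩ else 1,
    ⟨(Subgroup.inclusion le_top).comp φ, F.comp_mem' h (inclusion_mem_hom le_top), ?_⟩, ?_⟩
  · rintro ⟨x, hx⟩
    simp [hx]
  · rintro ⟨x, hx⟩
    simp [hx]

lemma isMor_conj (P : Subgroup S) (g : S) : F.IsMor P (fun x => g * x * g⁻¹) :=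
  ⟨((MulAut.conj g).toMonoidHom.comp P.subtype).codRestrict ⊤ fun _ => trivial,
    F.conj_mem' g _ fun x => by simp, fun x => by simp⟩

namespace IsMor

variable {P Q R : Subgroup S} {f g : S → S}

lemma map_mul (h : F.IsMor P f) {x y : S} (hx : x ∈ P) (hy : y ∈ P) : f (x * y) = f x * f y := by
  obtain ⟨φ, -, hf⟩ := h
  have := hf (⟨x, hx⟩ * ⟨y, hy⟩)
  rw [_root_.map_mul] at this
  simpa [← hf ⟨x, hx⟩, ← hf ⟨y, hy⟩] using this.symm

lemma map_one (h : F.IsMor P f) : f 1 = 1 := by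
  simpa using h.map_mul P.one_mem P.one_mem

lemma map_inv (h : F.IsMor P f) {x : S} (hx : x ∈ P) : f x⁻¹ = (f x)⁻¹ := by
  rw [eq_inv_iff_mul_eq_one, ← h.map_mul (P.inv_mem hx) hx, inv_mul_cancel, h.map_one]

lemma map_pow (h : F.IsMor P f) {x : S} (hx : x ∈ P) (n : ℕ) : f (x ^ n) = f x ^ n := by
  induction n with
  | zero => simp [h.map_one]
  | succ n ih => rw [pow_succ, pow_succ, h.map_mul (P.pow_mem hx n) hx, ih]

lemma injOn (h : F.IsMor P f) : Set.InjOn f P := by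
  obtain ⟨φ, hφ, hf⟩ := h
  intro x hx y hy hxy
  rw [← hf ⟨x, hx⟩, ← hf ⟨y, hy⟩] at hxy
  exact congrArg Subtype.val (F.injective' hφ (Subtype.ext hxy))

lemma congr (h : F.IsMor P f) (hfg : ∀ x ∈ P, f x = g x) : F.IsMor P g := by
  obtain ⟨φ, hφ, hf⟩ := h
  exact ⟨φ, hφ, fun x => (hf x).trans (hfg x x.2)⟩

lemma mono (h : F.IsMor P f) (hQ : Q ≤ P) : F.IsMor Q f := by
  obtain ⟨φ, hφ, hf⟩ := h
  exact ⟨φ.comp (Subgroup.inclusion hQ), F.comp_mem' (inclusion_mem_hom hQ) hφ,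
    fun x => hf (Subgroup.inclusion hQ x)⟩

lemma exists_iso (h : F.IsMor P f) :
    ∃ (R : Subgroup S) (e : P ≃* R), e ∈ F.Iso P R ∧ ∀ x : P, (e x : S) = f x := by
  obtain ⟨φ, hφ, hf⟩ := h
  obtain ⟨R, hR, e, he, he', rfl⟩ := F.factor' hφ
  exact ⟨R, e, ⟨he, he'⟩, hf⟩

/-- The factorization axiom lets the codomain shrink to the image, hence to any subgroup containing
it. -/
lemma exists_hom (h : F.IsMor P f) (hQ : ∀ x ∈ P, f x ∈ Q) :
    ∃ φ ∈ F.Hom P Q, ∀ x : P, (φ x : S) = f x := by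
  obtain ⟨R, e, he, hf⟩ := h.exists_iso
  have hR : R ≤ Q := fun r hr => by
    have := hQ _ (e.symm ⟨r, hr⟩).2
    rw [← hf] at this
    simpa using this
  exact ⟨(Subgroup.inclusion hR).comp e.toMonoidHom, F.comp_mem' he.1 (inclusion_mem_hom hR), hf⟩

lemma comp (hg : F.IsMor Q g) (hf : F.IsMor P f) (hQ : ∀ x ∈ P, f x ∈ Q) :
    F.IsMor P (fun x => g (f x)) := by
  obtain ⟨φ, hφ, hf⟩ := hf.exists_hom hQ
  obtain ⟨ψ, hψ, hg⟩ := hg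
  exact ⟨ψ.comp φ, F.comp_mem' hφ hψ, fun x => by simp [hg, hf]⟩

/-- The image of a morphism. -/
def image (h : F.IsMor P f) : Subgroup S where
  carrier := f '' P
  mul_mem' := by
    rintro _ _ ⟨x, hx, rfl⟩ ⟨y, hy, rfl⟩
    exact ⟨x * y, P.mul_mem hx hy, h.map_mul hx hy⟩
  one_mem' := ⟨1, P.one_mem, h.map_one⟩
  inv_mem' := by
    rintro _ ⟨x, hx, rfl⟩
    exact ⟨x⁻¹, P.inv_mem hx, h.map_inv hx⟩

lemma coe_image (h : F.IsMor P f) : (h.image : Set S) = f '' P := rfl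

lemma mem_image (h : F.IsMor P f) {y : S} : y ∈ h.image ↔ ∃ x ∈ P, f x = y := Iff.rfl

lemma apply_mem_image (h : F.IsMor P f) {x : S} (hx : x ∈ P) : f x ∈ h.image := ⟨x, hx, rfl⟩

lemma card_image (h : F.IsMor P f) : Nat.card h.image = Nat.card P :=
  Nat.card_image_of_injOn h.injOn

/-- The preimage of a subgroup under a morphism. -/
def comap (h : F.IsMor P f) (K : Subgroup S) : Subgroup S where
  carrier := {x | x ∈ P ∧ f x ∈ K}
  mul_mem' := by
    rintro x y ⟨hx, hx'⟩ ⟨hy, hy'⟩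
    exact ⟨P.mul_mem hx hy, by rw [h.map_mul hx hy]; exact K.mul_mem hx' hy'⟩
  one_mem' := ⟨P.one_mem, by rw [h.map_one]; exact K.one_mem⟩
  inv_mem' := by
    rintro x ⟨hx, hx'⟩
    exact ⟨P.inv_mem hx, by rw [h.map_inv hx]; exact K.inv_mem hx'⟩

lemma exists_inverse (h : F.IsMor P f) : ∃ g, F.IsMor h.image g ∧ ∀ x ∈ P, g (f x) = x := by
  obtain ⟨R, e, he, hf⟩ := h.exists_iso
  have hR : R = h.image := by
    ext y
    rw [mem_image]
    refine ⟨fun hy => ⟨e.symm ⟨y, hy⟩, (e.symm ⟨y, hy⟩).2, by simp [← hf]⟩, ?_⟩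
    rintro ⟨x, hx, rfl⟩
    rw [← hf ⟨x, hx⟩]
    exact (e _).2
  subst hR
  obtain ⟨g, hg, hg'⟩ := exists_isMor he.2
  refine ⟨g, hg, fun x hx => ?_⟩
  have := hg' (e ⟨x, hx⟩)
  rw [hf] at this
  simpa using this

lemma conj_image (h : F.IsMor P f) : F.Conj P h.image := by
  obtain ⟨φ, hφ, hf⟩ := h.exists_hom (Q := h.image) fun x hx => h.apply_mem_image hx
  obtain ⟨g, hg, hgf⟩ := h.exists_inverse
  obtain ⟨ψ, hψ, hg'⟩ := hg.exists_hom (Q := P) <| by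
    rintro _ ⟨x, hx, rfl⟩
    rwa [hgf x hx]
  have h1 : ∀ x, ψ (φ x) = x := fun x => Subtype.ext (by rw [hg', hf, hgf x x.2])
  refine ⟨φ.toMulEquiv ψ (MonoidHom.ext h1) (MonoidHom.ext fun y => ?_), hφ, hψ⟩
  obtain ⟨x, hx, hxy⟩ := y.2
  have : φ ⟨x, hx⟩ = y := Subtype.ext ((hf _).trans hxy)
  simp [← this, h1]

end IsMor

lemma exists_isMor_of_iso {P Q : Subgroup S} {e : P ≃* Q} (he : e ∈ F.Iso P Q) :
    ∃ f, F.IsMor P f ∧ f '' P = Q ∧ ∀ x : P, f x = e x := by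
  obtain ⟨f, hf, hfe⟩ := exists_isMor he.1
  refine ⟨f, hf, Set.ext fun y => ⟨?_, fun hy => ?_⟩, hfe⟩
  · rintro ⟨x, hx, rfl⟩
    rw [hfe ⟨x, hx⟩]
    exact (e.toMonoidHom ⟨x, hx⟩).2
  · exact ⟨e.symm ⟨y, hy⟩, (e.symm ⟨y, hy⟩).2, by simp [hfe]⟩

namespace Conj

variable {P Q R : Subgroup S}

lemma exists_isMor (h : F.Conj P Q) : ∃ f, F.IsMor P f ∧ f '' P = Q := by
  obtain ⟨e, he⟩ := h
  obtain ⟨f, hf, hf', -⟩ := exists_isMor_of_iso he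
  exact ⟨f, hf, hf'⟩

lemma symm (h : F.Conj P Q) : F.Conj Q P := by
  obtain ⟨e, he⟩ := h
  exact ⟨e.symm, he.2, he.1⟩

lemma trans (h : F.Conj P Q) (h' : F.Conj Q R) : F.Conj P R := by
  obtain ⟨e, he⟩ := h
  obtain ⟨e', he'⟩ := h'
  exact ⟨e.trans e', F.comp_mem' he.1 he'.1, F.comp_mem' he'.2 he.2⟩

lemma card_eq (h : F.Conj P Q) : Nat.card P = Nat.card Q := by
  obtain ⟨e, -⟩ := h
  exact Nat.card_congr e.toEquiv

end Conj

lemma conj_refl (P : Subgroup S) : F.Conj P P := ⟨1, (F.aut P).one_mem⟩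

/-! ### Fully normalized subgroups and saturation -/

lemma exists_isFullyNormalized [Finite S] (F : FusionSystem S) (P : Subgroup S) :
    ∃ V, F.Conj P V ∧ F.IsFullyNormalized V := by
  obtain ⟨V, hV, hmax⟩ := Set.exists_max_image {V | F.Conj P V}
    (fun V => Nat.card (Subgroup.normalizer (V : Set S))) (Set.toFinite _) ⟨P, conj_refl P⟩
  exact ⟨V, hV, fun Q hQ => hmax Q (Conj.trans hV hQ)⟩

lemma mem_autS {P : Subgroup S} {α : MulAut P} :
    α ∈ autS P ↔ ∃ g ∈ Subgroup.normalizer (P : Set S), ∀ x : P, (α x : S) = g * x * g⁻¹ := by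
  constructor
  · rintro ⟨g, rfl⟩
    exact ⟨g, g.2, fun x => by simp⟩
  · rintro ⟨g, hg, h⟩
    exact ⟨⟨g, hg⟩, MulEquiv.ext fun x => Subtype.ext (by simp [h])⟩

lemma autS_le_aut (P : Subgroup S) : autS P ≤ F.aut P := by
  intro α hα
  have key : ∀ β ∈ autS P, MulEquiv.toMonoidHom β ∈ F.Hom P P := by
    intro β hβ
    obtain ⟨g, -, h⟩ := mem_autS.1 hβ
    exact F.conj_mem' g _ h
  exact ⟨key α hα, key _ ((autS P).inv_mem hα)⟩

lemma isPGroup_autS {p : ℕ} (hS : IsPGroup p S) (P : Subgroup S) : IsPGroup p (autS P) :=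
  (hS.to_subgroup _).of_surjective P.normalizerMonoidHom.rangeRestrict
    P.normalizerMonoidHom.rangeRestrict_surjective

lemma mem_extensionDomain {P Q : Subgroup S} {φ : P ≃* Q} {g : S} :
    g ∈ extensionDomain φ ↔ ∃ h : g ∈ Subgroup.normalizer (P : Set S),
      MulAut.congr φ (P.normalizerMonoidHom ⟨g, h⟩) ∈ autS Q := by
  simp only [extensionDomain, Subgroup.mem_map, Subgroup.mem_comap]
  constructor
  · rintro ⟨g, h, rfl⟩
    exact ⟨g.2, h⟩
  · rintro ⟨h, h'⟩
    exact ⟨⟨g, h⟩, h', rfl⟩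

/-- Every isomorphism onto a fully normalized subgroup can be altered so as to extend to the
normalizer. -/
theorem IsSaturated.exists_isMor_normalizer [Finite S] {p : ℕ} [Fact p.Prime] (hS : IsPGroup p S)
    (hF : F.IsSaturated p) {Y V : Subgroup S} (hV : F.IsFullyNormalized V) (hYV : F.Conj Y V) :
    ∃ f, F.IsMor (Subgroup.normalizer (Y : Set S)) f ∧ f '' Y = V := by
  obtain ⟨φ, hφ⟩ := hYV
  obtain ⟨hcent, T, hT⟩ := hF.sylow V hV
  have hKle : (autS Y).map (MulAut.congr φ).toMonoidHom ≤ F.aut V := by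
    rintro _ ⟨α, hα, rfl⟩
    have hα' := autS_le_aut (F := F) Y hα
    exact ⟨F.comp_mem' hφ.2 (F.comp_mem' hα'.1 hφ.1), F.comp_mem' (F.comp_mem' hφ.2 hα'.2) hφ.1⟩
  have hKp : IsPGroup p
      (((autS Y).map (MulAut.congr φ).toMonoidHom).subgroupOf (F.aut V)) :=
    ((isPGroup_autS hS Y).map _).comap_of_injective _ (Subgroup.subtype_injective _)
  obtain ⟨T', hT'⟩ := hKp.exists_le_sylow
  -- By Sylow, correcting φ by χ⁻¹ carries Aut_S(Y) into Aut_S(V). Then all of N_S(Y) lies in the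
  -- extension domain.
  obtain ⟨χ, rfl⟩ := MulAction.exists_smul_eq (F.aut V) T T'
  set φ' : Y ≃* V := φ.trans ((χ⁻¹ : F.aut V) : MulAut V) with hφ'
  have hiso : φ' ∈ F.Iso Y V :=
    ⟨F.comp_mem' hφ.1 (χ⁻¹).2.1, F.comp_mem' (χ⁻¹).2.2 hφ.2⟩
  obtain ⟨ψ, hψ, hle, hext⟩ := hF.extension Y V φ' hiso hcent
  have hdom : Subgroup.normalizer (Y : Set S) ≤ extensionDomain φ' := by
    intro g hg
    refine mem_extensionDomain.2 ⟨hg, ?_⟩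
    set α := Y.normalizerMonoidHom ⟨g, hg⟩ with hα
    have hmem : MulAut.congr φ α ∈ (autS Y).map (MulAut.congr φ).toMonoidHom :=
      ⟨α, ⟨_, rfl⟩, rfl⟩
    have h1 := hT' (show (⟨_, hKle hmem⟩ : F.aut V) ∈ _ from hmem)
    change _ ∈ ((χ • T : Sylow p (F.aut V)) : Subgroup (F.aut V)) at h1
    rw [Sylow.coe_subgroup_smul, Subgroup.mem_pointwise_smul_iff_inv_smul_mem] at h1
    rw [← hT]
    refine ⟨_, h1, ?_⟩
    ext x
    simp [hφ', MulAut.smul_def]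
  obtain ⟨f, hf, hfψ⟩ := exists_isMor hψ
  refine ⟨f, hf.mono hdom, Set.ext fun v => ⟨?_, fun hv => ?_⟩⟩
  · rintro ⟨y, hy, rfl⟩
    rw [hfψ ⟨y, hle hy⟩, show (ψ ⟨y, hle hy⟩ : S) = φ' ⟨y, hy⟩ from hext ⟨y, hy⟩]
    exact (φ' _).2
  · refine ⟨φ'.symm ⟨v, hv⟩, (φ'.symm ⟨v, hv⟩).2, ?_⟩
    rw [hfψ ⟨_, hle (φ'.symm ⟨v, hv⟩).2⟩]
    refine (hext _).trans ?_
    simp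

end FusionSystem

/-! ### Two facts on p-groups -/

lemma IsPGroup.exists_mem_normalizer_of_lt {S : Type*} [Group S] [Finite S] {p : ℕ}
    [Fact p.Prime] (hS : IsPGroup p S) {H K : Subgroup S} (hHK : H < K) :
    ∃ g ∈ K, g ∈ Subgroup.normalizer (H : Set S) ∧ g ∉ H := by
  have := (hS.to_subgroup K).isNilpotent
  have hlt : H.subgroupOf K < ⊤ := lt_top_iff_ne_top.2 fun h =>
    hHK.not_ge (Subgroup.subgroupOf_eq_top.1 h)
  obtain ⟨g, hg, hg'⟩ := SetLike.exists_of_lt (Group.normalizerCondition_of_isNilpotent _ hlt)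
  refine ⟨g, g.2, Subgroup.mem_normalizer_iff.2 fun h => ?_, hg'⟩
  rw [Subgroup.mem_normalizer_iff] at hg
  constructor
  · intro hh
    exact (hg ⟨h, hHK.le hh⟩).1 hh
  · intro hh
    have hK : h ∈ K := by
      have := K.mul_mem (K.mul_mem (K.inv_mem g.2) (hHK.le hh)) g.2
      simpa [mul_assoc] using this
    exact (hg ⟨h, hK⟩).2 hh

lemma IsPGroup.normal_le_sylow {G : Type*} [Group G] {p : ℕ} {O : Subgroup G} [O.Normal]
    (hO : IsPGroup p O) (T : Sylow p G) : O ≤ T := by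
  have h := IsPGroup.to_sup_of_normal_right T.isPGroup' hO
  rw [← T.is_maximal' h le_sup_left]
  exact le_sup_right

/-! ### Abelian strongly closed subgroups are normal -/

namespace FusionSystem

variable {S : Type*} [Group S] {F : FusionSystem S}

/-- `D` is strongly closed in `F`: no element of `D` is `F`-conjugate to an element outside `D`. -/
def IsStronglyClosed (F : FusionSystem S) (D : Subgroup S) : Prop :=
  ∀ (Q : Subgroup S) (f : S → S), F.IsMor Q f → ∀ x ∈ Q, x ∈ D → f x ∈ D

namespace IsStronglyClosed

variable {D : Subgroup S}

lemma normal (hD : F.IsStronglyClosed D) : D.Normal :=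
  ⟨fun x hx g => hD ⊤ _ (isMor_conj ⊤ g) x trivial hx⟩

lemma image_eq [Finite S] (hD : F.IsStronglyClosed D) {Q : Subgroup S} {f : S → S}
    (hf : F.IsMor Q f) (hDQ : D ≤ Q) : f '' D = D := by
  refine Set.eq_of_subset_of_ncard_le ?_ ?_
  · rintro _ ⟨x, hx, rfl⟩
    exact hD Q f hf x (hDQ hx) hx
  · exact (hf.injOn.mono hDQ).ncard_image.ge

/-- The automorphisms of `R` which centralize both `R ∩ D` and `R / (R ∩ D)`. -/
def stabilizing (_hD : F.IsStronglyClosed D) (R : Subgroup S) : Subgroup (F.aut R) where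
  carrier := {α | (∀ x : R, (x : S) ∈ D → (α : MulAut R) x = x) ∧
    ∀ x : R, ((α : MulAut R) x : S) * (x : S)⁻¹ ∈ D}
  mul_mem' := by
    rintro α β ⟨hα, hα'⟩ ⟨hβ, hβ'⟩
    refine ⟨fun x hx => ?_, fun x => ?_⟩
    · simp [hβ x hx, hα x hx]
    · have := D.mul_mem (hα' ((β : MulAut R) x)) (hβ' x)
      simpa [mul_assoc] using this
  one_mem' := ⟨fun x _ => by simp, fun x => by simp⟩
  inv_mem' := by
    rintro α ⟨hα, hα'⟩
    refine ⟨fun x hx => ?_, fun x => ?_⟩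
    · exact (MulEquiv.symm_apply_eq (α : MulAut R)).2 (hα x hx).symm
    · have := D.inv_mem (hα' ((α : MulAut R)⁻¹ x))
      simpa using this

lemma apply_mem (hD : F.IsStronglyClosed D) {R : Subgroup S} (α : F.aut R) {x : R}
    (hx : (x : S) ∈ D) : ((α : MulAut R) x : S) ∈ D := by
  obtain ⟨f, hf, -, h⟩ := exists_isMor_of_iso α.2
  rw [← h x]
  exact hD R f hf x x.2 hx

/-- Aut_F(R) preserves R ∩ D by strong closure, so conjugation preserves both defining conditions.
-/
lemma stabilizing_normal (hD : F.IsStronglyClosed D) (R : Subgroup S) :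
    (hD.stabilizing R).Normal := by
  refine ⟨fun α hα β => ⟨fun x hx => ?_, fun x => ?_⟩⟩
  · have h := hα.1 ((β : MulAut R)⁻¹ x) (hD.apply_mem β⁻¹ hx)
    change (β : MulAut R) ((α : MulAut R) ((β : MulAut R)⁻¹ x)) = x
    rw [h]
    simp
  · have h := hα.2 ((β : MulAut R)⁻¹ x)
    have h' := hD.apply_mem β (x := (α : MulAut R) ((β : MulAut R)⁻¹ x) * ((β : MulAut R)⁻¹ x)⁻¹)
      (by simpa using h)
    simpa using h'

/-- Put c = α(x)x⁻¹ ∈ D. Since α fixes the powers of c, αⁿ(x) = cⁿx, so α has order dividing |S|. -/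
lemma isPGroup_stabilizing [Finite S] {p : ℕ} [Fact p.Prime] (hS : IsPGroup p S)
    (hD : F.IsStronglyClosed D) (R : Subgroup S) : IsPGroup p (hD.stabilizing R) := by
  obtain ⟨k, hk⟩ := IsPGroup.iff_card.1 hS
  rintro ⟨α, hα⟩
  have key : ∀ (n : ℕ) (x : R), (((α : MulAut R) ^ n) x : S)
      = (((α : MulAut R) x : S) * (x : S)⁻¹) ^ n * x := by
    intro n x
    induction n with
    | zero => simp
    | succ n ih =>
      have hmem : ((((α : MulAut R) ^ n) x * x⁻¹ : R) : S) ∈ D := by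
        simpa [ih] using D.pow_mem (hα.2 x) n
      have h := hα.1 _ hmem
      have h1 : (α : MulAut R) (((α : MulAut R) ^ n) x)
          = (((α : MulAut R) ^ n) x * x⁻¹) * (α : MulAut R) x := by
        rw [map_mul, map_inv, mul_inv_eq_iff_eq_mul] at h
        exact h
      rw [pow_succ', MulAut.mul_apply, h1, pow_succ]
      simp [ih, mul_assoc]
  refine ⟨k, Subtype.ext (Subtype.ext (MulEquiv.ext fun x => Subtype.ext ?_))⟩
  have := key (p ^ k) x
  rw [← hk, pow_card_eq_one', one_mul] at this
  simpa [hk] using this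

lemma sup_le_comap (hD : F.IsStronglyClosed D) {P Q R : Subgroup S} {f : S → S} (hf : F.IsMor P f)
    (hP : Q ⊔ D ≤ P) (hR : ∀ x ∈ Q, f x ∈ R) : ∀ x ∈ Q ⊔ D, f x ∈ R ⊔ D := by
  have : Q ⊔ D ≤ hf.comap (R ⊔ D) := sup_le
    (fun x hx => ⟨hP (le_sup_left (a := Q) hx), le_sup_left (a := R) (hR x hx)⟩)
    (fun x hx => ⟨hP (le_sup_right (a := Q) hx),
      le_sup_right (a := R) (hD P f hf x (hP (le_sup_right (a := Q) hx)) hx)⟩)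
  exact fun x hx => (this hx).2

/-- Conjugation by a ∈ N_D(R) centralizes R ∩ D and R/(R ∩ D), so it lies in a normal p-subgroup of
Aut_F(R). Its conjugate by γ therefore stays in the Sylow subgroup Aut_S(R), which puts a in the
extension domain of γ. As D ≰ R, some such a lies outside R. -/
lemma exists_extension_of_normalizer [Finite S] {p : ℕ} [Fact p.Prime] (hS : IsPGroup p S)
    (hF : F.IsSaturated p) (hcomm : IsMulCommutative D) (hD : F.IsStronglyClosed D)
    {R : Subgroup S} (hR : F.IsFullyNormalized R) (hDR : ¬ D ≤ R) {γ : S → S}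
    (hγ : F.IsMor R γ) (hγR : γ '' R = R) :
    ∃ (E : Subgroup S) (g : S → S), R < E ∧ F.IsMor E g ∧ ∀ x ∈ R, g x = γ x := by
  have hn := hD.normal
  obtain ⟨R', e, he, hef⟩ := hγ.exists_iso
  obtain rfl : R' = R := by
    refine SetLike.coe_injective (Eq.trans (Set.ext fun y => ⟨fun hy => ?_, ?_⟩) hγR)
    · exact ⟨e.symm ⟨y, hy⟩, (e.symm ⟨y, hy⟩).2, by simp [← hef]⟩
    · rintro ⟨x, hx, rfl⟩
      rw [← hef ⟨x, hx⟩]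
      exact (e _).2
  obtain ⟨hcent, T, hT⟩ := hF.sylow R' hR
  obtain ⟨ψ, hψ, hle, hext⟩ := hF.extension R' R' e he hcent
  obtain ⟨g, hg, hgψ⟩ := exists_isMor hψ
  refine ⟨extensionDomain e, g, lt_of_le_of_ne hle ?_, hg, fun x hx => ?_⟩
  swap
  · rw [hgψ ⟨x, hle hx⟩, ← hef ⟨x, hx⟩]
    exact hext ⟨x, hx⟩
  -- Normalizers grow inside RD; the D-component of a new normalizing element rd again normalizes R
  -- and is not in R.
  obtain ⟨a, haD, ha, haR⟩ : ∃ a ∈ D, a ∈ Subgroup.normalizer (R' : Set S) ∧ a ∉ R' := by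
    obtain ⟨b, hb, hb', hbR⟩ := hS.exists_mem_normalizer_of_lt
      (H := R') (K := R' ⊔ D) (left_lt_sup.2 hDR)
    obtain ⟨r, hr, d, hd, rfl⟩ := Subgroup.mem_sup_of_normal_right.1 hb
    exact ⟨d, hd, (Subgroup.mul_mem_cancel_left _ (Subgroup.le_normalizer hr)).1 hb',
      fun h => hbR (R'.mul_mem hr h)⟩
  intro heq
  apply haR
  rw [heq]
  refine mem_extensionDomain.2 ⟨ha, ?_⟩
  have := hD.stabilizing_normal R'
  have hOT := (hD.isPGroup_stabilizing hS R').normal_le_sylow T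
  set α : F.aut R' := ⟨R'.normalizerMonoidHom ⟨a, ha⟩, autS_le_aut R' ⟨_, rfl⟩⟩ with hα
  have hαO : α ∈ hD.stabilizing R' := by
    refine ⟨fun x hx => Subtype.ext ?_, fun x => ?_⟩
    · have : a * x = x * a := congrArg Subtype.val
        (mul_comm' (⟨a, haD⟩ : D) ⟨x, hx⟩)
      simp [hα, this]
    · have := D.mul_mem haD (hn.conj_mem _ (D.inv_mem haD) (x : S))
      simpa [hα, mul_assoc] using this
  have h2 := hOT (this.conj_mem α hαO ⟨e, he⟩)
  rw [← hT]
  refine ⟨_, h2, ?_⟩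
  ext x
  simp [hα]

/-- Downward induction on |Q|, with n exceeding |S| − |Q|. A morphism on Q is written as β⁻¹γα,
where α and β lead to a fully normalized R and γ is an automorphism of R. Each factor extends to a
strictly larger subgroup, so the induction applies to it. -/
theorem exists_extension [Finite S] {p : ℕ} [Fact p.Prime] (hS : IsPGroup p S)
    (hF : F.IsSaturated p) (hcomm : IsMulCommutative D) (hD : F.IsStronglyClosed D)
    (n : ℕ) (Q : Subgroup S) (hn : Nat.card S < Nat.card Q + n) {f : S → S} (hf : F.IsMor Q f) :
    ∃ g, F.IsMor (Q ⊔ D) g ∧ ∀ x ∈ Q, g x = f x := by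
  induction n generalizing Q f with
  | zero => exact absurd hn (not_lt.2 (by simpa using Q.card_le_card_group))
  | succ n ih =>
  by_cases hDQ : D ≤ Q
  · exact ⟨f, by rwa [sup_eq_left.2 hDQ], fun _ _ => rfl⟩
  have hlarge : ∀ {Q' E : Subgroup S} {g : S → S}, Nat.card Q' = Nat.card Q → Q' < E →
      F.IsMor E g → ∃ g', F.IsMor (Q' ⊔ D) g' ∧ ∀ x ∈ Q', g' x = g x := by
    intro Q' E g hc hlt hg
    have : Nat.card Q' < Nat.card E := by
      exact Set.ncard_lt_ncard (SetLike.coe_ssubset_coe.2 hlt) (Set.toFinite _)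
    obtain ⟨g', hg', h⟩ := ih E (by omega) hg
    exact ⟨g', hg'.mono (sup_le_sup_right hlt.le D), fun x hx => h x (hlt.le hx)⟩
  have hnorm : ∀ Q' : Subgroup S, Nat.card Q' = Nat.card Q →
      Q' < Subgroup.normalizer (Q' : Set S) := by
    intro Q' hc
    have htop : Q' < ⊤ := lt_top_iff_ne_top.2 fun h => hDQ (by
      have hQ : Q = ⊤ := Subgroup.eq_top_of_card_eq Q (by rw [← hc, h, Subgroup.card_top])
      rw [hQ]
      exact le_top)
    obtain ⟨g, -, hg, hg'⟩ := hS.exists_mem_normalizer_of_lt htop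
    exact lt_of_le_of_ne Subgroup.le_normalizer fun h => hg' (by rw [h]; exact hg)
  obtain ⟨R, hQR, hR⟩ := exists_isFullyNormalized F Q
  have hPR := hf.conj_image.symm.trans hQR
  obtain ⟨α₀, hα₀, hα₀R⟩ := hF.exists_isMor_normalizer hS hR hQR
  obtain ⟨β₀, hβ₀, hβ₀R⟩ := hF.exists_isMor_normalizer hS hR hPR
  obtain ⟨α, hα, hαα₀⟩ := hlarge rfl (hnorm Q rfl) hα₀
  obtain ⟨β, hβ, hββ₀⟩ := hlarge hf.card_image (hnorm _ hf.card_image) hβ₀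
  have hαQ : ∀ x ∈ Q, α x ∈ R := fun x hx => by
    rw [hαα₀ x hx]
    exact hα₀R.subset ⟨x, hx, rfl⟩
  have hβP : β '' hf.image = R := by
    rw [← hβ₀R]
    exact Set.image_congr hββ₀
  have hαR : (hα.mono le_sup_left).image = R := SetLike.coe_injective <| by
    rw [IsMor.coe_image, ← hα₀R]
    exact Set.image_congr hαα₀
  obtain ⟨α', hα', hα'α⟩ := (hα.mono (le_sup_left : Q ≤ _)).exists_inverse
  rw [hαR] at hα'
  have hα'Q : ∀ x ∈ R, α' x ∈ Q ∧ α (α' x) = x := by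
    intro x hx
    rw [← hαR] at hx
    obtain ⟨y, hy, rfl⟩ := hx
    rw [hα'α y hy]
    exact ⟨hy, rfl⟩
  have hγ : F.IsMor R (fun x => β (f (α' x))) :=
    ((hβ.mono le_sup_left).comp hf fun x hx => hf.apply_mem_image hx).comp hα'
      fun x hx => (hα'Q x hx).1
  have hγR : (fun x => β (f (α' x))) '' R = R := by
    rw [← hβP]
    ext y
    constructor
    · rintro ⟨x, hx, rfl⟩
      exact ⟨_, hf.apply_mem_image (hα'Q x (hβP.subset hx)).1, rfl⟩
    · rintro ⟨_, ⟨x, hx, rfl⟩, rfl⟩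
      refine ⟨α x, hβP.ge (hαQ x hx), ?_⟩
      simp only [hα'α x hx]
  -- Otherwise α⁻¹ would be defined on D and map it onto itself, inside Q.
  have hDR : ¬ D ≤ R := by
    intro hDR
    refine hDQ fun x hx => ?_
    obtain ⟨y, hy, rfl⟩ := (hD.image_eq hα' hDR).ge hx
    exact (hα'Q y (hDR hy)).1
  obtain ⟨E, γ₀, hRE, hγ₀, hγγ₀⟩ :=
    hD.exists_extension_of_normalizer hS hF hcomm hR hDR hγ hγR
  obtain ⟨γ, hγ', hγ₀γ⟩ := hlarge hQR.card_eq.symm hRE hγ₀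
  obtain ⟨β', hβ', hβ'β⟩ := hβ.exists_inverse
  have hle : R ⊔ D ≤ hβ.image := sup_le
    (fun x hx => by
      obtain ⟨y, hy, rfl⟩ := hβP.ge hx
      exact hβ.apply_mem_image (le_sup_left (a := hf.image) hy))
    (fun x hx => by
      obtain ⟨y, hy, rfl⟩ := (hD.image_eq hβ le_sup_right).ge hx
      exact hβ.apply_mem_image (le_sup_right (b := D) hy))
  have hγval : ∀ x ∈ R, γ x = β (f (α' x)) := fun x hx => by rw [hγ₀γ x hx, hγγ₀ x hx]
  refine ⟨fun x => β' (γ (α x)), ((hβ'.mono hle).comp hγ' (hD.sup_le_comap hγ' le_rfl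
    fun x hx => ?_)).comp hα (hD.sup_le_comap hα le_rfl hαQ), fun x hx => ?_⟩
  · rw [hγval x hx]
    exact hγR.subset ⟨x, hx, rfl⟩
  · simp only
    rw [hγval _ (hαQ x hx), hα'α x hx,
      hβ'β _ (le_sup_left (a := hf.image) (hf.apply_mem_image hx))]

/-- An abelian strongly closed subgroup is normal in the fusion system. -/
theorem isNormal [Finite S] {p : ℕ} [Fact p.Prime] (hS : IsPGroup p S)
    (hF : F.IsSaturated p) (hcomm : IsMulCommutative D) (hD : F.IsStronglyClosed D) :
    F.IsNormal D := by
  intro Q R φ hφ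
  obtain ⟨f, hf, hfφ⟩ := exists_isMor hφ
  obtain ⟨g, hg, hgf⟩ := hD.exists_extension hS hF hcomm (Nat.card S + 1) Q (by omega) hf
  have him := hD.image_eq hg le_sup_right
  obtain ⟨ψ, hψ, hψg⟩ := hg
  refine ⟨Q ⊔ D, ⊤, ψ, hψ, ⟨le_sup_left, fun x => ?_⟩, le_sup_right, ?_⟩
  · rw [hψg, ← hfφ]
    exact hgf x x.2
  · ext y
    rw [← SetLike.mem_coe (p := D), ← him]
    constructor
    · rintro ⟨_, ⟨x, hx, rfl⟩, rfl⟩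
      exact ⟨x, hx, (hψg x).symm⟩
    · rintro ⟨x, hx, rfl⟩
      exact ⟨_, ⟨⟨x, le_sup_right (a := Q) hx⟩, hx, rfl⟩, hψg _⟩

end IsStronglyClosed

end FusionSystem

/-! ### Commutators with an abelian subgroup -/

section Commutators

variable {S : Type*} [Group S]

/-- The elements of `C_D(x) ∩ [x, D]`, where `D` is abelian and normalized by `x`. -/
def fixedCommutators (D : Subgroup S) (x : S) : Set S :=
  {z | z ∈ D ∧ x * z = z * x ∧ ∃ a ∈ D, z = x * a * x⁻¹ * a⁻¹}

/-- As D is abelian and normalized by x, a ↦ [x,a] is an endomorphism of D, with range [x,D] and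
kernel C_D(x). -/
lemma exists_commutatorHom {D : Subgroup S} (hcomm : IsMulCommutative D) {x : S}
    (hx : x ∈ Subgroup.normalizer (D : Set S)) :
    ∃ κ : D →* D, ∀ a : D, (κ a : S) = x * a * x⁻¹ * (a : S)⁻¹ := by
  have hx' : ∀ a : D, x * a * x⁻¹ ∈ D := fun a => (Subgroup.mem_normalizer_iff.1 hx a).1 a.2
  refine ⟨MonoidHom.mk' (fun a => ⟨x * a * x⁻¹ * (a : S)⁻¹, D.mul_mem (hx' a) (D.inv_mem a.2)⟩)
    fun a b => Subtype.ext ?_, fun a => rfl⟩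
  have h : (a : S)⁻¹ * (x * b * x⁻¹ * (b : S)⁻¹) = x * b * x⁻¹ * (b : S)⁻¹ * (a : S)⁻¹ :=
    congrArg Subtype.val (mul_comm' (a⁻¹) (⟨x * b * x⁻¹, hx' b⟩ * b⁻¹))
  simp only [Subgroup.coe_mul]
  calc x * (a * b) * x⁻¹ * ((a : S) * b)⁻¹
      = x * a * x⁻¹ * (x * b * x⁻¹ * (b : S)⁻¹ * (a : S)⁻¹) := by group
    _ = x * a * x⁻¹ * (a : S)⁻¹ * (x * b * x⁻¹ * (b : S)⁻¹) := by rw [← h]; group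

lemma MonoidHom.card_range_mul_card_ker {G H : Type*} [Group G] [Group H] (κ : G →* H) :
    Nat.card κ.range * Nat.card κ.ker = Nat.card G := by
  rw [← Subgroup.index_ker, mul_comm, Subgroup.card_mul_index]

lemma MonoidHom.card_comap {G H : Type*} [Group G] [Group H] (κ : G →* H) {K : Subgroup H}
    (hK : K ≤ κ.range) : Nat.card (K.comap κ) = Nat.card K * Nat.card κ.ker := by
  have h := (κ.comp (K.comap κ).subtype).card_range_mul_card_ker
  rw [MonoidHom.range_comp, Subgroup.range_subtype, Subgroup.map_comap_eq,
    inf_eq_right.2 hK] at h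
  have hker : (κ.comp (K.comap κ).subtype).ker = κ.ker.subgroupOf (K.comap κ) := rfl
  rw [← h, hker, Nat.card_congr (Subgroup.subgroupOfEquivOfLe (κ.ker_le_comap K)).toEquiv]

lemma Subgroup.card_mul_relIndex {G : Type*} [Group G] {H K : Subgroup G} (h : H ≤ K) :
    Nat.card H * H.relIndex K = Nat.card K := by
  rw [← Subgroup.relIndex_bot_left, Subgroup.relIndex_mul_relIndex _ _ _ bot_le h,
    Subgroup.relIndex_bot_left]

/-- The product set MZ has |M||Z|/|M ∩ Z| elements and lies in C. -/
lemma Subgroup.card_mul_card_le {G : Type*} [Group G] [Finite G] {M Z C : Subgroup G}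
    (hM : M ≤ C) (hZ : Z ≤ C) :
    Nat.card M * Nat.card Z ≤ Nat.card C * Nat.card (M ⊓ Z : Subgroup G) := by
  have h1 : Nat.card (M ⊓ Z : Subgroup G) * M.relIndex Z = Nat.card Z := by
    rw [← Subgroup.inf_relIndex_right, Subgroup.card_mul_relIndex inf_le_right]
  have h2 : Nat.card M * M.relIndex C = Nat.card C := Subgroup.card_mul_relIndex hM
  have h3 : M.relIndex Z ≤ M.relIndex C :=
    Subgroup.relIndex_le_of_le_right hZ fun h => Nat.card_pos.ne' (h2.symm.trans (by simp [h]))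
  calc Nat.card M * Nat.card Z
      = Nat.card (M ⊓ Z : Subgroup G) * (Nat.card M * M.relIndex Z) := by rw [← h1]; ring
    _ ≤ Nat.card (M ⊓ Z : Subgroup G) * (Nat.card M * M.relIndex C) := by gcongr
    _ = _ := by rw [h2, mul_comm]

lemma exists_coe_eq_fixedCommutators {D : Subgroup S} {x : S} {κ : D →* D}
    (hκ : ∀ a : D, (κ a : S) = x * a * x⁻¹ * (a : S)⁻¹) :
    (((κ.range ⊓ κ.ker).map D.subtype : Subgroup S) : Set S) = fixedCommutators D x := by
  have hker : ∀ z : D, κ z = 1 ↔ x * z = z * x := fun z => by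
    rw [Subtype.ext_iff, hκ, Subgroup.coe_one, mul_inv_eq_one, mul_inv_eq_iff_eq_mul]
  ext z
  constructor
  · rintro ⟨_, ⟨⟨a, rfl⟩, h⟩, rfl⟩
    exact ⟨(κ a).2, (hker _).1 h, a, a.2, hκ a⟩
  · rintro ⟨hz, h, a, ha, hza⟩
    exact ⟨⟨z, hz⟩, ⟨⟨⟨a, ha⟩, Subtype.ext ((hκ _).trans hza.symm)⟩, (hker _).2 h⟩, rfl⟩

/-- The p-group ⟨x⟩ acts on the nontrivial p-group [x,D], so it fixes a nontrivial element there. -/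
lemma IsPGroup.one_lt_ncard_fixedCommutators [Finite S] {p : ℕ} [Fact p.Prime]
    (hS : IsPGroup p S) {D : Subgroup S} (hcomm : IsMulCommutative D) {x : S}
    (hx : x ∈ Subgroup.normalizer (D : Set S)) (hxD : x ∉ Subgroup.centralizer (D : Set S)) :
    1 < (fixedCommutators D x).ncard := by
  obtain ⟨κ, hκ⟩ := exists_commutatorHom hcomm hx
  have hxn : ∀ a : D, x * a * x⁻¹ ∈ D := fun a => (Subgroup.mem_normalizer_iff.1 hx a).1 a.2
  set K := κ.range.map D.subtype with hK
  have hxK : Subgroup.zpowers x ≤ Subgroup.normalizer (K : Set S) := by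
    rw [Subgroup.zpowers_le, Subgroup.mem_normalizer_iff_map_conj_eq]
    refine Subgroup.eq_of_le_of_card_ge ?_ ?_
    · rintro _ ⟨_, ⟨_, ⟨a, rfl⟩, rfl⟩, rfl⟩
      refine ⟨_, ⟨⟨x * a * x⁻¹, hxn a⟩, rfl⟩, ?_⟩
      simp [hκ, mul_assoc]
    · exact (Subgroup.card_map_of_injective (K := K) (f := (MulAut.conj x).toMonoidHom)
        (MulAut.conj x).injective).ge
  let _ : MulAction (Subgroup.zpowers x) K := MulAction.compHom K (Subgroup.inclusion hxK)
  have hsmul : ∀ (b : K), ((⟨x, Subgroup.mem_zpowers x⟩ : Subgroup.zpowers x) • b : K)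
      = (⟨x, hxK (Subgroup.mem_zpowers x)⟩ : Subgroup.normalizer (K : Set S)) • b := fun b => rfl
  have hKne : Nontrivial K := by
    rw [Subgroup.nontrivial_iff_exists_ne_one]
    by_contra! h
    refine hxD (Subgroup.mem_centralizer_iff.2 fun a ha => ?_)
    have := h _ (Subgroup.mem_map_of_mem _ ⟨⟨a, ha⟩, rfl⟩)
    rw [Subgroup.coe_subtype, hκ, mul_inv_eq_one, mul_inv_eq_iff_eq_mul] at this
    exact this.symm
  obtain ⟨k, hk, hcard⟩ := (hS.to_subgroup K).nontrivial_iff_card.1 hKne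
  obtain ⟨b, hb, hb1⟩ := (hS.to_subgroup (Subgroup.zpowers x))
    |>.exists_fixed_point_of_prime_dvd_card_of_fixed_point K
      (hcard ▸ dvd_pow_self p hk.ne') (a := 1) fun g => by
        change (Subgroup.inclusion hxK g) • (1 : K) = 1
        exact smul_one _
  have hbx := hb ⟨x, Subgroup.mem_zpowers x⟩
  rw [hsmul] at hbx
  have hbx' : x * b * x⁻¹ = b := congrArg Subtype.val hbx
  obtain ⟨_, ⟨a, rfl⟩, hab⟩ := b.2
  rw [Set.one_lt_ncard]
  refine ⟨1, ⟨D.one_mem, by simp, 1, D.one_mem, by simp⟩, b,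
    ⟨by rw [← hab]; exact (κ a).2, mul_inv_eq_iff_eq_mul.1 hbx', a, a.2, ?_⟩,
    fun h => hb1 (Subtype.ext h)⟩
  rw [← hab, ← hκ]
  rfl

/-- An elementary abelian subgroup `X` of `N(D)` whose image in `Aut(D)` is nontrivial and has
order at least `|C_D(x) ∩ [x, D]|` for each `x ∈ X ∖ D`. -/
structure IsOffending (p : ℕ) (D X : Subgroup S) : Prop where
  le_normalizer : X ≤ Subgroup.normalizer (D : Set S)
  comm : ∀ x ∈ X, ∀ y ∈ X, x * y = y * x
  pow_eq_one : ∀ x ∈ X, x ^ p = 1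
  not_le : ¬ X ≤ D
  card_le : ∀ x ∈ X, x ∉ D →
    (fixedCommutators D x).ncard * Nat.card (X ⊓ D : Subgroup S) ≤ Nat.card X

end Commutators

/-! ### Construction of an offending subgroup -/

namespace FusionSystem

variable {S : Type*} [Group S] {F : FusionSystem S}

theorem isOffending_of_conj [Finite S] {p : ℕ} {D D' : Subgroup S} (hcomm : IsMulCommutative D)
    (hexp : ∀ x ∈ D, x ^ p = 1) (hDD' : F.Conj D D') (hne : D' ≠ D)
    (hle : D' ≤ Subgroup.normalizer (D : Set S)) : IsOffending p D D' := by
  obtain ⟨f, hf, hfD⟩ := hDD'.exists_isMor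
  have hD' : ∀ x ∈ D', ∃ a ∈ D, f a = x := fun x hx => hfD.ge hx
  have hcommD' : ∀ x ∈ D', ∀ y ∈ D', x * y = y * x := by
    intro x hx y hy
    obtain ⟨a, ha, rfl⟩ := hD' x hx
    obtain ⟨b, hb, rfl⟩ := hD' y hy
    rw [← hf.map_mul ha hb, ← hf.map_mul hb ha,
      show a * b = b * a from congrArg Subtype.val (mul_comm' (⟨a, ha⟩ : D) ⟨b, hb⟩)]
  refine ⟨hle, hcommD', fun x hx => ?_, fun h => hne ?_, fun x hx hxD => ?_⟩
  · obtain ⟨a, ha, rfl⟩ := hD' x hx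
    rw [← hf.map_pow ha, hexp a ha, hf.map_one]
  · exact Subgroup.eq_of_le_of_card_ge h hDD'.card_eq.le
  · obtain ⟨κ, hκ⟩ := exists_commutatorHom hcomm (hle hx)
    rw [← hDD'.card_eq, ← κ.card_range_mul_card_ker]
    refine Nat.mul_le_mul ?_ ?_
    · rw [← exists_coe_eq_fixedCommutators hκ]
      change Nat.card ((κ.range ⊓ κ.ker).map D.subtype) ≤ _
      rw [Subgroup.card_map_of_injective D.subtype_injective]
      exact Subgroup.card_le_of_le inf_le_left
    · rw [← Subgroup.card_map_of_injective (K := κ.ker) D.subtype_injective]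
      refine Subgroup.card_le_of_le fun z hz => ⟨⟨z, hz.2⟩, Subtype.ext ?_, rfl⟩
      rw [hκ, hcommD' x hx z hz.1]
      simp

theorem exists_isOffending_of_weaklyClosed [Finite S] {p : ℕ} [Fact p.Prime] (hS : IsPGroup p S)
    (hF : F.IsSaturated p) {D : Subgroup S} (hcomm : IsMulCommutative D)
    (hexp : ∀ x ∈ D, x ^ p = 1) (hcent : Subgroup.centralizer (D : Set S) = D)
    (hwc : ∀ D', F.Conj D D' → D' = D) (hns : ¬ F.IsStronglyClosed D) :
    ∃ X, IsOffending p D X := by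
  have hDcomm : ∀ x ∈ D, ∀ y ∈ D, x * y = y * x := fun x hx y hy =>
    congrArg Subtype.val (mul_comm' (⟨x, hx⟩ : D) ⟨y, hy⟩)
  have himage : ∀ (P : Subgroup S) (f : S → S), F.IsMor P f → D ≤ P → f '' D = D := fun P f hf h =>
    congrArg SetLike.coe (hwc _ (hf.mono h).conj_image)
  have hnorm : D.Normal := ⟨fun x hx g => (himage ⊤ _ (isMor_conj ⊤ g) le_top).subset ⟨x, hx, rfl⟩⟩
  have hmemN : ∀ x, x ∈ Subgroup.normalizer (D : Set S) := fun x => by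
    rw [Subgroup.normalizer_eq_top_iff.2 hnorm]
    trivial
  -- D is abelian, so D ≤ N_S(U). The morphism from N_S(U) that takes U to V is thus defined on D
  -- and preserves it by weak closure.
  have hfn : ∀ {U V : Subgroup S}, U ≤ D → F.Conj U V → F.IsFullyNormalized V → V ≤ D := by
    intro U V hU hUV hV
    obtain ⟨f, hf, hfU⟩ := hF.exists_isMor_normalizer hS hV hUV
    have hDU : D ≤ Subgroup.normalizer (U : Set S) := fun d hd =>
      Subgroup.mem_normalizer_iff_map_conj_eq.2 <| Subgroup.ext fun u => by
        have : ∀ v ∈ U, MulAut.conj d v = v := fun v hv => by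
          rw [MulAut.conj_apply, hDcomm d hd v (hU hv), mul_inv_cancel_right]
        constructor
        · rintro ⟨v, hv, rfl⟩
          change MulAut.conj d v ∈ U
          rwa [this v hv]
        · exact fun hu => ⟨u, hu, this u hu⟩
    rw [← SetLike.coe_subset_coe, ← hfU, ← himage _ f hf hDU]
    exact Set.image_mono hU
  set 𝒴 : Set S := {y | y ∉ D ∧ ∃ f, F.IsMor (Subgroup.zpowers y) f ∧ f y ∈ D}
  have hne : 𝒴.Nonempty := by
    unfold IsStronglyClosed at hns
    push Not at hns
    obtain ⟨Q, f, hf, x, hxQ, hxD, hfx⟩ := hns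
    obtain ⟨g, hg, hgf⟩ := hf.exists_inverse
    refine ⟨f x, hfx, g, hg.mono ?_, by rwa [hgf x hxQ]⟩
    rw [Subgroup.zpowers_le]
    exact hf.apply_mem_image hxQ
  obtain ⟨y, ⟨hyD, f₀, hf₀, hf₀y⟩, hmax⟩ := Set.exists_max_image 𝒴
    (fun y => (fixedCommutators D y).ncard) (Set.toFinite _) hne
  obtain ⟨κ, hκ⟩ := exists_commutatorHom hcomm (hmemN y)
  set Z := (κ.range ⊓ κ.ker).map D.subtype with hZ
  have hZcoe : (Z : Set S) = fixedCommutators D y := exists_coe_eq_fixedCommutators hκ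
  have hZcard : (fixedCommutators D y).ncard = Nat.card Z := by rw [← hZcoe]; rfl
  have hZD : Z ≤ D := Subgroup.map_subtype_le _
  set C := κ.ker.map D.subtype with hC
  have hmemC : ∀ a, a ∈ C ↔ a ∈ D ∧ y * a = a * y := by
    intro a
    constructor
    · rintro ⟨b, hb, rfl⟩
      have h := hκ b
      rw [MonoidHom.mem_ker.1 hb, Subgroup.coe_one, eq_comm, mul_inv_eq_one,
        mul_inv_eq_iff_eq_mul] at h
      exact ⟨b.2, h⟩
    · rintro ⟨ha, h⟩
      exact ⟨⟨a, ha⟩, Subtype.ext (by rw [hκ]; simp [h]), rfl⟩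
  have hZC : Z ≤ C := Subgroup.map_mono inf_le_right
  obtain ⟨Z₁, ⟨hZ₁Z, f₁, hf₁, hf₁D⟩, hmax₁⟩ := Set.exists_max_image
    {Z₁ : Subgroup S | Z₁ ≤ Z ∧ ∃ f, F.IsMor (Subgroup.zpowers y ⊔ Z₁) f ∧
      ∀ w ∈ Subgroup.zpowers y ⊔ Z₁, f w ∈ D} (fun Z₁ => Nat.card Z₁) (Set.toFinite _)
    ⟨⊥, bot_le, f₀, by rwa [sup_bot_eq], by
      rw [sup_bot_eq]
      exact fun w hw => (((Subgroup.zpowers_le.2 ⟨Subgroup.mem_zpowers y, hf₀y⟩ :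
        Subgroup.zpowers y ≤ hf₀.comap D)) hw).2⟩
  set Y := Subgroup.zpowers y ⊔ Z₁ with hY
  have hyY : y ∈ Y := le_sup_left (b := Z₁) (Subgroup.mem_zpowers y)
  have hZ₁Y : Z₁ ≤ Y := le_sup_right
  obtain ⟨V, hYV, hV⟩ := exists_isFullyNormalized F Y
  have hVD : V ≤ D := hfn (U := hf₁.image) (by rintro _ ⟨w, hw, rfl⟩; exact hf₁D w hw)
    (hf₁.conj_image.symm.trans hYV) hV
  obtain ⟨g, hg, hgY⟩ := hF.exists_isMor_normalizer hS hV hYV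
  have hYN : Y ≤ Subgroup.normalizer (Y : Set S) := Subgroup.le_normalizer
  have hgYD : ∀ w ∈ Y, g w ∈ D := fun w hw => hVD (hgY.subset ⟨w, hw, rfl⟩)
  set N := D ⊓ Subgroup.normalizer (Y : Set S) with hN
  have hgN : F.IsMor N g := hg.mono inf_le_right
  set M := hgN.comap D with hM
  have hMN : M ≤ N := fun a ha => ha.1
  -- g(a) and g(y) commute in D, and g is injective.
  have hMC : M ≤ C := by
    rintro a ⟨haN, hga⟩
    refine (hmemC a).2 ⟨haN.1, ?_⟩
    have hy := hYN hyY
    refine hg.injOn (Subgroup.mul_mem _ hy haN.2) (Subgroup.mul_mem _ haN.2 hy) ?_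
    rw [hg.map_mul hy haN.2, hg.map_mul haN.2 hy, hDcomm _ (hgYD y hyY) _ hga]
  -- g moves ⟨y, M ∩ Z⟩ into D, so maximality of Z₁ applies.
  have hMZ : M ⊓ Z = Z₁ := by
    have hle : Z₁ ≤ M ⊓ Z := le_inf
      (fun z hz => ⟨⟨hZD (hZ₁Z hz), hYN (hZ₁Y hz)⟩, hgYD z (hZ₁Y hz)⟩) hZ₁Z
    have hle' : Subgroup.zpowers y ⊔ M ⊓ Z ≤ hg.comap D := sup_le
      (Subgroup.zpowers_le.2 ⟨hYN hyY, hgYD y hyY⟩) fun z hz => ⟨hz.1.1.2, hz.1.2⟩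
    exact (Subgroup.eq_of_le_of_card_ge hle (hmax₁ _ ⟨inf_le_right, g,
      hg.mono fun w hw => (hle' hw).1, fun w hw => (hle' hw).2⟩)).symm
  -- If [y,a] ∈ Z₁ then a normalizes ⟨y, Z₁⟩. These a form a group of order |Z₁||C|.
  have hN' : ((Z₁.subgroupOf D).comap κ).map D.subtype ≤ N := by
    rintro _ ⟨a, ha, rfl⟩
    refine ⟨a.2, Subgroup.mem_normalizer_iff_map_conj_eq.2 ?_⟩
    refine Subgroup.eq_of_le_of_card_ge ?_ (Subgroup.card_map_of_injective (K := Y)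
      (f := (MulAut.conj (a : S)).toMonoidHom) (MulAut.conj (a : S)).injective).ge
    refine Subgroup.map_le_iff_le_comap.2 (sup_le (Subgroup.zpowers_le.2 ?_) fun z hz => ?_)
    · have h : y⁻¹ * (κ a : S) ∈ Y := Y.mul_mem (Y.inv_mem hyY) (hZ₁Y ha)
      have h' := Y.inv_mem h
      rw [hκ] at h'
      change (a : S) * y * (a : S)⁻¹ ∈ Y
      simpa [mul_assoc] using h'
    · change (a : S) * z * (a : S)⁻¹ ∈ Y
      rw [hDcomm _ a.2 z (hZD (hZ₁Z hz)), mul_inv_cancel_right]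
      exact hZ₁Y hz
  have hZ₁κ : Z₁.subgroupOf D ≤ κ.range := by
    intro z hz
    obtain ⟨w, ⟨hw, -⟩, hwz⟩ := hZ₁Z hz
    exact (Subtype.ext hwz : w = z) ▸ hw
  have hcard : Nat.card Z * Nat.card M ≤ Nat.card N := by
    calc Nat.card Z * Nat.card M
        = Nat.card M * Nat.card Z := mul_comm _ _
      _ ≤ Nat.card C * Nat.card Z₁ := by
        have := Subgroup.card_mul_card_le hMC hZC
        rwa [hMZ] at this
      _ = Nat.card (((Z₁.subgroupOf D).comap κ).map D.subtype) := by
        rw [hC, Subgroup.card_map_of_injective D.subtype_injective,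
          Subgroup.card_map_of_injective D.subtype_injective, κ.card_comap hZ₁κ, mul_comm,
          Nat.card_congr (Subgroup.subgroupOfEquivOfLe (hZ₁Z.trans hZD)).toEquiv]
      _ ≤ Nat.card N := Subgroup.card_le_of_le hN'
  have hXD : Nat.card (hgN.image ⊓ D : Subgroup S) = Nat.card M := by
    rw [← (hgN.mono hMN).card_image]
    congr 2
    ext x
    constructor
    · rintro ⟨⟨a, ha, rfl⟩, hx⟩
      exact ⟨a, ⟨ha, hx⟩, rfl⟩
    · rintro ⟨a, ⟨ha, hx⟩, rfl⟩
      exact ⟨⟨a, ha, rfl⟩, hx⟩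
  refine ⟨hgN.image, fun x _ => hmemN x, ?_, ?_, fun hle => ?_, ?_⟩
  · rintro _ ⟨a, ha, rfl⟩ _ ⟨b, hb, rfl⟩
    rw [← hgN.map_mul ha hb, hDcomm a ha.1 b hb.1, hgN.map_mul hb ha]
  · rintro _ ⟨a, ha, rfl⟩
    rw [← hgN.map_pow ha, hexp a ha.1, hgN.map_one]
  · rw [inf_eq_left.2 hle, hgN.card_image] at hXD
    have h1 : 1 < Nat.card Z := by
      rw [← hZcard]
      exact hS.one_lt_ncard_fixedCommutators hcomm (hmemN y) (by rwa [hcent])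
    rw [← hXD] at hcard
    exact absurd hcard (not_le.2 (lt_mul_of_one_lt_left Nat.card_pos h1))
  · rintro _ ⟨a, ha, rfl⟩ hxD
    obtain ⟨g', hg', hg'g⟩ := hgN.exists_inverse
    -- g⁻¹ moves x = g(a) back into D, so the choice of y bounds the commutators of x by |Z|.
    have hmem : g a ∈ 𝒴 := ⟨hxD, g', hg'.mono (Subgroup.zpowers_le.2 (hgN.apply_mem_image ha)), by
      rw [hg'g a ha]
      exact ha.1⟩
    have := hmax _ hmem
    rw [hXD, hgN.card_image]
    refine le_trans (Nat.mul_le_mul_right _ ?_) hcard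
    rwa [← hZcard]

/-- A self-centralizing elementary abelian subgroup which is not normal in a saturated fusion
system has an offending subgroup. -/
theorem exists_isOffending [Finite S] {p : ℕ} [Fact p.Prime] (hS : IsPGroup p S)
    (hF : F.IsSaturated p) {D : Subgroup S} (hcomm : IsMulCommutative D)
    (hexp : ∀ x ∈ D, x ^ p = 1) (hcent : Subgroup.centralizer (D : Set S) = D)
    (hnn : ¬ F.IsNormal D) : ∃ X, IsOffending p D X := by
  by_cases htop : Subgroup.normalizer (D : Set S) = ⊤
  · by_cases hwc : ∀ D', F.Conj D D' → D' = D
    · exact exists_isOffending_of_weaklyClosed hS hF hcomm hexp hcent hwc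
        fun h => hnn (h.isNormal hS hF hcomm)
    · push Not at hwc
      obtain ⟨D', hconj, hne⟩ := hwc
      exact ⟨D', isOffending_of_conj hcomm hexp hconj hne (htop ▸ le_top)⟩
  -- An element normalizing N_S(D) but not D gives a second conjugate of D inside N_S(D).
  · obtain ⟨g, -, hg, hgD⟩ := hS.exists_mem_normalizer_of_lt (lt_top_iff_ne_top.2 htop)
    refine ⟨_, isOffending_of_conj hcomm hexp (isMor_conj (F := F) D g).conj_image (fun h => hgD ?_) ?_⟩
    · exact Subgroup.mem_normalizer_iff_map_conj_eq.2 (SetLike.coe_injective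
        (congrArg SetLike.coe h))
    · rintro _ ⟨x, hx, rfl⟩
      exact (Subgroup.mem_normalizer_iff.1 hg x).1 (Subgroup.le_normalizer hx)

end FusionSystem

/-! ### Jordan blocks of an element of order dividing p -/

section Jordan

variable {A : Type*} [AddCommGroup A] {p : ℕ} [Fact p.Prime] [Module (ZMod p) A]

lemma exists_ne_zero_mem_ker_inf_range {τ : A →ₗ[ZMod p] A} (hτ : τ ^ p = 1)
    {W : Submodule (ZMod p) A} (hW : W ≤ W.comap τ) {a : A} (ha : a ∈ W) (hτa : τ a ≠ a) :
    ∃ w ∈ W, w ≠ 0 ∧ w ∈ LinearMap.ker (τ - 1) ⊓ LinearMap.range (τ - 1) := by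
  have : Nontrivial A := ⟨_, _, hτa⟩
  have : CharP (Module.End (ZMod p) A) p :=
    charP_of_injective_algebraMap (algebraMap (ZMod p) (Module.End (ZMod p) A)).injective p
  have hnil : (τ - 1) ^ p = 0 := by
    have h := sub_pow_char_of_commute (R := Module.End (ZMod p) A) p (Commute.one_right τ)
    rw [h, hτ, one_pow, sub_self]
  have hex : ∃ n, ((τ - 1 : Module.End (ZMod p) A) ^ n) a = 0 := ⟨p, by rw [hnil]; rfl⟩
  have hmem : ∀ n, ((τ - 1 : Module.End (ZMod p) A) ^ n) a ∈ W := fun n => by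
    induction n with
    | zero => simpa using ha
    | succ n ih =>
      rw [pow_succ', Module.End.mul_apply]
      exact W.sub_mem (hW ih) ih
  classical
  -- τ moves a, so the least power of τ − 1 killing a is at least the second. The last nonzero
  -- iterate is then both fixed by τ and in the image of τ − 1.
  obtain ⟨n, hn⟩ : ∃ n, Nat.find hex = n + 2 := by
    refine Nat.exists_eq_add_of_le' ?_
    rw [Nat.le_find_iff]
    intro m hm h
    interval_cases m
    · rw [pow_zero, Module.End.one_apply] at h
      exact hτa (by rw [h, map_zero])
    · rw [pow_one] at h
      exact hτa (sub_eq_zero.1 h)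
  refine ⟨_, hmem (n + 1), Nat.find_min hex (by omega), ?_, ?_⟩
  · change (τ - 1) (((τ - 1 : Module.End (ZMod p) A) ^ (n + 1)) a) = 0
    rw [← Module.End.mul_apply, ← pow_succ', show n + 1 + 1 = n + 2 from rfl,
      ← hn]
    exact Nat.find_spec hex
  · rw [pow_succ', Module.End.mul_apply]
    exact LinearMap.mem_range_self _ _

/-- Each nontrivial block contributes a nonzero vector to C_A(τ) ∩ [τ,A], and vectors from distinct
summands are independent. -/
theorem numNontrivialBlocks_le_jordanRank [Finite A] {τ : A →ₗ[ZMod p] A} (hτ : τ ^ p = 1) {n : ℕ}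
    {W : Fin n → Submodule (ZMod p) A} (hW : IsJordanDecomposition τ W) :
    numNontrivialBlocks τ W ≤ jordanRank τ := by
  have hex : ∀ i : {i : Fin n // ∃ a ∈ W i, τ a ≠ a}, ∃ w ∈ W i, w ≠ 0 ∧
      w ∈ LinearMap.ker (τ - 1) ⊓ LinearMap.range (τ - 1) := by
    rintro ⟨i, a, ha, hτa⟩
    exact exists_ne_zero_mem_ker_inf_range hτ (hW.2 i).2.1 ha hτa
  choose w hw hw0 hwK using hex
  have hli : LinearIndependent (ZMod p) w :=
    (hW.1.submodule_iSupIndep.comp Subtype.val_injective).linearIndependent _ hw hw0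
  have hli' : LinearIndependent (ZMod p)
      (fun i => (⟨w i, hwK i⟩ : (LinearMap.ker (τ - 1) ⊓ LinearMap.range (τ - 1) :
        Submodule (ZMod p) A))) :=
    LinearIndependent.of_comp (Submodule.subtype _) hli
  classical
  rw [numNontrivialBlocks, Nat.card_eq_fintype_card]
  exact hli'.fintype_card_le_finrank

end Jordan

/-! ### Transfer to Γ and A -/

theorem corollary2p9 {p : ℕ} [Fact p.Prime]
    {Γ : Type*} [Group Γ] [Finite Γ] (hΓ : primeToResidual p Γ = ⊤)
    {A : Type*} [AddCommGroup A] [Module (ZMod p) A] [Finite A]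
    (ρ : Representation (ZMod p) Γ A) (hρ : Function.Injective ρ)
    {S : Type*} [Group S] [Finite S] (hS : IsPGroup p S)
    (F : FusionSystem S) (hF : F.IsSaturated p) (hreal : F.Realizes ρ) :
    ∃ (m : ℕ) (B : Subgroup Γ), 1 ≤ m ∧ IsElementaryAbelianOfRank p m B ∧
      ∀ τ ∈ B, τ ≠ 1 → jordanRank (ρ τ) ≤ m ∧
        ∀ (n : ℕ) (W : Fin n → Submodule (ZMod p) A), IsJordanDecomposition (ρ τ) W →
          numNontrivialBlocks (ρ τ) W ≤ m := by
  obtain ⟨D, hcomm, hcent, hnn, χ, f, hχ⟩ := hreal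
  have hexp : ∀ x ∈ D, x ^ p = 1 := by
    intro x hx
    obtain ⟨a, ha⟩ := f.surjective ⟨x, hx⟩
    have h : a ^ p = 1 := by
      change Multiplicative.ofAdd (p • a.toAdd) = 1
      rw [← Nat.cast_smul_eq_nsmul (ZMod p), CharP.cast_eq_zero, zero_smul, ofAdd_zero]
    have h' := congrArg f h
    rw [map_pow, ha, map_one] at h'
    exact congrArg Subtype.val h'
  obtain ⟨X, hX⟩ := FusionSystem.exists_isOffending hS hF hcomm hexp hcent hnn
  -- Conjugation on D, read in Γ; its kernel is X ∩ D because D is self-centralizing and the action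
  -- on A is faithful.
  set θ : X →* Γ := (χ.symm.toMonoidHom.comp (D.normalizerMonoidHom.codRestrict (F.aut D)
    fun x => FusionSystem.autS_le_aut D ⟨x, rfl⟩)).comp (Subgroup.inclusion hX.le_normalizer)
    with hθ
  have hθf : ∀ (x : X) (a : A), (f (Multiplicative.ofAdd (ρ (θ x) a)) : S)
      = x * f (Multiplicative.ofAdd a) * (x : S)⁻¹ := by
    intro x a
    rw [hχ]
    simp [hθ]
  have hker : θ.ker = (X ⊓ D).subgroupOf X := by
    ext x
    rw [MonoidHom.mem_ker, Subgroup.mem_subgroupOf, Subgroup.mem_inf, and_iff_right x.2]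
    constructor
    · intro h
      rw [← hcent, Subgroup.mem_centralizer_iff]
      intro d hd
      obtain ⟨a, ha⟩ := f.surjective ⟨d, hd⟩
      have := hθf x a.toAdd
      rw [h, map_one, Module.End.one_apply, ofAdd_toAdd, ha, eq_mul_inv_iff_mul_eq] at this
      exact this
    · intro h
      apply hρ
      rw [map_one]
      ext a
      have h1 := hθf x a
      rw [show (x : S) * f (Multiplicative.ofAdd a) = f (Multiplicative.ofAdd a) * x from
        congrArg Subtype.val (mul_comm' (⟨x, h⟩ : D) _), mul_inv_cancel_right] at h1
      exact f.injective (Subtype.ext h1)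
  have hcard : Nat.card θ.range * Nat.card (X ⊓ D : Subgroup S) = Nat.card X := by
    rw [← θ.card_range_mul_card_ker, hker,
      Nat.card_congr (Subgroup.subgroupOfEquivOfLe inf_le_left).toEquiv]
  obtain ⟨m, hm⟩ := IsPGroup.iff_card.1
    ((hS.to_subgroup X).of_surjective θ.rangeRestrict θ.rangeRestrict_surjective)
  refine ⟨m, θ.range, Nat.one_le_iff_ne_zero.2 ?_, ⟨⟨⟨?_⟩⟩, ?_, hm⟩, ?_⟩
  · rintro rfl
    rw [hm, pow_zero, one_mul] at hcard
    exact hX.not_le (inf_eq_left.1 (Subgroup.eq_of_le_of_card_ge inf_le_left hcard.ge))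
  · rintro ⟨_, x, rfl⟩ ⟨_, y, rfl⟩
    refine Subtype.ext ?_
    change θ x * θ y = θ y * θ x
    rw [← map_mul, ← map_mul, show x * y = y * x from Subtype.ext (hX.comm x x.2 y y.2)]
  · rintro _ ⟨x, rfl⟩
    rw [← map_pow, show x ^ p = 1 from Subtype.ext (hX.pow_eq_one x x.2), map_one]
  · rintro _ ⟨x, rfl⟩ hx
    have hxD : (x : S) ∉ D := fun h => hx <| by
      rw [← MonoidHom.mem_ker, hker]
      exact ⟨x.2, h⟩
    have hrank : jordanRank (ρ (θ x)) ≤ m := by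
      have hle := hX.card_le x x.2 hxD
      rw [← hcard, hm] at hle
      have hle' := Nat.le_of_mul_le_mul_right hle Nat.card_pos
      refine (Nat.pow_le_pow_iff_right (Fact.out : p.Prime).one_lt).1 (le_trans ?_ hle')
      have hpow := Module.natCard_eq_pow_finrank (K := ZMod p)
        (V := (LinearMap.ker (ρ (θ x) - 1) ⊓ LinearMap.range (ρ (θ x) - 1) :
          Submodule (ZMod p) A))
      rw [Nat.card_zmod] at hpow
      rw [jordanRank, ← hpow]
      -- Under f, C_A(τ) ∩ [τ,A] embeds in C_D(x) ∩ [x,D], whose order is at most p^m.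
      refine Nat.card_le_card_of_injective (β := fixedCommutators D (x : S))
        (fun a => ⟨f (Multiplicative.ofAdd a.1), (f _).2, ?_, ?_⟩) fun a b hab => ?_
      · have h1 := hθf x a
        rw [sub_eq_zero.1 (LinearMap.mem_ker.1 a.2.1), Module.End.one_apply,
          eq_mul_inv_iff_mul_eq] at h1
        exact h1.symm
      · obtain ⟨b, hb⟩ := a.2.2
        refine ⟨f (Multiplicative.ofAdd b), (f _).2, ?_⟩
        rw [← hθf, ← hb, LinearMap.sub_apply, Module.End.one_apply, ofAdd_sub, map_div,
          div_eq_mul_inv]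
        rfl
      · exact Subtype.ext (f.injective (Subtype.ext (Subtype.mk.inj hab)))
    refine ⟨hrank, fun n W hW => (numNontrivialBlocks_le_jordanRank ?_ hW).trans hrank⟩
    rw [← map_pow, ← map_pow, show x ^ p = 1 from Subtype.ext (hX.pow_eq_one x x.2), map_one,
      map_one]
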